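/- Let $X$ be a closed polygon in $\mathbb{R}^3$ with nodes $X(i)$, where the index $i$ is taken modulo $n$ ($n\ge 1$). Assume that $X$ is generic, i.e. no four consecutive nodes $X(i-1),X(i),X(i+1),X(i+2)$ are coplanar. Assume also that there are a point $O\in\mathbb{R}^3$ and an affine plane $H\not\ni O$ such that, for every $i$, the open ray from $O$ through $X(i)$ meets $H$ in a point $P(i)$, and the closed polygon $P$ with consecutive nodes $P(i)$ is a convex planar polygon. (Convex means that the closed polygonal curve $P$ is simple and that, for each edge, all nodes of $P$ lie in one closed half-plane of $H$ bounded by the line through that edge; straight angles are allowed.) Put $$\Delta(i+\tfrac12)=\left[X(i+2)-X(i+1),\;X(i+1)-X(i),\;X(i)-X(i-1)\right],$$ where $[u,v,w]$ is the determinant of $u,v,w\in\mathbb{R}^3$. Then $X$ has at least $4$ flattening points, i.e. there are at least $4$ indices $i$ modulo $n$ with $$\Delta(i-\tfrac12)\cdot\Delta(i+\tfrac12)<0 .$$ -/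

import Mathlib

/-- The standard volume `[u, v, w]` in 3-space, i.e. the determinant with rows `u`, `v`, `w`. -/
def vol (u v w : Fin 3 → ℝ) : ℝ :=
  Matrix.det (Matrix.of ![u, v, w])

/-- For a closed polygon with nodes `X i`, `i : ZMod n`, the number `halfDelta X i` is
`Δ(i + 1/2) = [X(i+2) - X(i+1), X(i+1) - X(i), X(i) - X(i-1)]`. -/
def halfDelta {n : ℕ} (X : ZMod n → Fin 3 → ℝ) (i : ZMod n) : ℝ :=
  vol (X (i + 2) - X (i + 1)) (X (i + 1) - X i) (X i - X (i - 1))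

/-- The node `i` is a flattening point: `Δ(i - 1/2) * Δ(i + 1/2) < 0`. -/
def IsFlattening {n : ℕ} (X : ZMod n → Fin 3 → ℝ) (i : ZMod n) : Prop :=
  halfDelta X (i - 1) * halfDelta X i < 0

/-- No four consecutive nodes are coplanar. -/
def IsGeneric {n : ℕ} (X : ZMod n → Fin 3 → ℝ) : Prop :=
  ∀ i : ZMod n, ¬ Coplanar ℝ {X (i - 1), X i, X (i + 1), X (i + 2)}

/-- The closed polygonal curve with nodes `P i` has no self-intersections: walking along each edge
from `P i` (included) to `P (i + 1)` (excluded), no point is visited twice. -/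
def IsSimplePolygon {n : ℕ} (P : ZMod n → Fin 3 → ℝ) : Prop :=
  Function.Injective fun q : ZMod n × Set.Ico (0 : ℝ) 1 =>
    AffineMap.lineMap (k := ℝ) (P q.1) (P (q.1 + 1)) (q.2 : ℝ)

/-- The closed polygon `P` is a convex polygon of the plane `H`: its nodes lie in `H`, it is simple,
and for every edge the line through that edge has all nodes (weakly) on one side.
Straight angles are allowed. -/
structure IsConvexPolygonIn {n : ℕ} (H : AffineSubspace ℝ (Fin 3 → ℝ))
    (P : ZMod n → Fin 3 → ℝ) : Prop where
  mem : ∀ i, P i ∈ H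
  simple : IsSimplePolygon P
  sameSide : ∀ i j k, (line[ℝ, P i, P (i + 1)]).WSameSide (P j) (P k)

/-- `P` is the radial projection of `X` into the plane `H` with center `O`: for each `i`, the point
`P i` is where the open ray from `O` through `X i` meets `H`. -/
def IsRadialProjection {n : ℕ} (O : Fin 3 → ℝ) (H : AffineSubspace ℝ (Fin 3 → ℝ))
    (X P : ZMod n → Fin 3 → ℝ) : Prop :=
  ∀ i, P i ∈ H ∧ ∃ r : ℝ, 0 < r ∧ X i - O = r • (P i - O)

open Finset

/-! Move `O` to the origin. The plane through three consecutive nodes is the level set 1 of a dual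
vector, `triangleNormal` divided by `vol`. Consecutive planes share an edge, so consecutive dual
vectors differ by a multiple `c i` of that edge's normal, and in a positively oriented strictly
convex cone `c i` has the sign of `halfDelta`. Summing around the polygon gives `∑ c i • edgeNormal
i = 0` (`sum_smul_edgeNormal`).

Hence `c` is orthogonal to every sequence `edgeNormal i ⬝ᵥ v`. With fewer than four sign changes,
`c` has constant sign or two sign blocks (`constant_sign_or_two_blocks`). Taking for `v` a node, or
a vector along the intersection of the two edge planes where the blocks begin, gives a nonzero
sequence whose signs agree with those of `c` up to a global sign. This contradicts orthogonality.
The sign pattern in the second case is `vol_edgeNormal_pos`.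

Straight angles are removed by a small perturbation that makes the cone strictly convex and keeps
every sign of `halfDelta` (`IsConvexCone.four_le_ncard`). -/

/-! ### Determinant identities. -/

theorem vol_apply (u v w : Fin 3 → ℝ) :
    vol u v w = u 0 * v 1 * w 2 - u 0 * v 2 * w 1 - u 1 * v 0 * w 2 + u 1 * v 2 * w 0
      + u 2 * v 0 * w 1 - u 2 * v 1 * w 0 := by
  simp [vol, Matrix.det_fin_three]

theorem dotProduct_crossProduct_eq_vol (u v w : Fin 3 → ℝ) :
    crossProduct u v ⬝ᵥ w = vol u v w := by
  simp [vol_apply, cross_apply, dotProduct, Fin.sum_univ_three]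
  ring

/-- Two planes through `b` meet along `b`: `(a × b) × (b × c) = [a, b, c] b`. -/
theorem vol_crossProduct_chain (a b c d e : Fin 3 → ℝ) :
    vol (crossProduct a b) (crossProduct b c) (crossProduct d e) = vol a b c * vol d e b := by
  simp [vol_apply, cross_apply]
  ring

theorem vol_mul_dotProduct (A B C N y : Fin 3 → ℝ) :
    vol A C N * (B ⬝ᵥ y) =
      vol A B N * (C ⬝ᵥ y) + vol B C N * (A ⬝ᵥ y) - vol A B C * (N ⬝ᵥ y) := by
  simp [vol_apply, dotProduct, Fin.sum_univ_three]
  ring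

theorem ZMod.natCast_ne_natCast_of_lt {n i k : ℕ} (hi : i < n) (hk : k < n) (h : i ≠ k) :
    (i : ZMod n) ≠ k := by
  intro e
  rw [ZMod.natCast_eq_natCast_iff', Nat.mod_eq_of_lt hi, Nat.mod_eq_of_lt hk] at e
  exact h e

/-- The normal vector of the triangle `u v w`. -/
def triangleNormal (u v w : Fin 3 → ℝ) : Fin 3 → ℝ :=
  crossProduct u v + crossProduct v w + crossProduct w u

/-- Once divided by their volumes, both normals take the value 1 at `q` and `r`, so their difference
is orthogonal to both and hence parallel to `q × r`. -/
theorem triangleNormal_sub (p q r s : Fin 3 → ℝ) :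
    vol p q r • triangleNormal q r s - vol q r s • triangleNormal p q r =
      vol (s - r) (r - q) (q - p) • crossProduct q r := by
  ext k
  fin_cases k <;> simp [triangleNormal, vol_apply, cross_apply] <;> ring

/-! ### Edge normals of a strictly convex cone. -/

/-- A closed polygon seen from the origin as a strictly convex, positively oriented polygon. -/
def IsStrictlyConvexCone {n : ℕ} (Y : ZMod n → Fin 3 → ℝ) : Prop :=
  ∀ i j : ZMod n, j ≠ i → j ≠ i + 1 → 0 < vol (Y i) (Y (i + 1)) (Y j)

/-- The normal vector of the plane through the origin and the edge from `Y i` to `Y (i + 1)`. -/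
def edgeNormal {n : ℕ} (Y : ZMod n → Fin 3 → ℝ) (i : ZMod n) : Fin 3 → ℝ :=
  crossProduct (Y i) (Y (i + 1))

theorem edgeNormal_dotProduct {n : ℕ} (Y : ZMod n → Fin 3 → ℝ) (i : ZMod n) (y : Fin 3 → ℝ) :
    edgeNormal Y i ⬝ᵥ y = vol (Y i) (Y (i + 1)) y :=
  dotProduct_crossProduct_eq_vol _ _ _

namespace IsStrictlyConvexCone

variable {n : ℕ} {Y : ZMod n → Fin 3 → ℝ}

theorem edgeNormal_dotProduct_pos (hY : IsStrictlyConvexCone Y) {i j : ZMod n} (h : j ≠ i)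
    (h' : j ≠ i + 1) : 0 < edgeNormal Y i ⬝ᵥ Y j := by
  rw [edgeNormal_dotProduct]
  exact hY i j h h'

theorem edgeNormal_dotProduct_nonneg (hY : IsStrictlyConvexCone Y) (i j : ZMod n) :
    0 ≤ edgeNormal Y i ⬝ᵥ Y j := by
  by_cases h : j = i
  · subst h; rw [edgeNormal_dotProduct, vol_apply]; exact le_of_eq (by ring)
  by_cases h' : j = i + 1
  · subst h'; rw [edgeNormal_dotProduct, vol_apply]; exact le_of_eq (by ring)
  exact (hY.edgeNormal_dotProduct_pos h h').le

theorem vol_consecutive_pos (hY : IsStrictlyConvexCone Y) (hn : 3 ≤ n) (i : ZMod n) :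
    0 < vol (Y (i - 1)) (Y i) (Y (i + 1)) := by
  have h := hY (i - 1) (i + 1) ?_ ?_
  · simpa using h
  · intro h
    have : ((2 : ℕ) : ZMod n) = (0 : ℕ) := by push_cast; linear_combination h
    exact ZMod.natCast_ne_natCast_of_lt (by omega) (by omega) (by omega) this
  · intro h
    have : ((1 : ℕ) : ZMod n) = (0 : ℕ) := by push_cast; linear_combination h
    exact ZMod.natCast_ne_natCast_of_lt (by omega) (by omega) (by omega) this

theorem vol_edgeNormal_succ_pos (hY : IsStrictlyConvexCone Y) (hn : 3 ≤ n) (b : ZMod n) {i : ℕ}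
    (hi : 1 ≤ i) (hin : i + 1 < n) :
    0 < vol (edgeNormal Y (b + i)) (edgeNormal Y (b + (i + 1 : ℕ))) (edgeNormal Y b) := by
  have key := vol_crossProduct_chain (Y (b + i)) (Y (b + i + 1)) (Y (b + i + 1 + 1)) (Y b)
    (Y (b + 1))
  have e : b + ((i + 1 : ℕ) : ZMod n) = b + i + 1 := by push_cast; ring
  rw [e]
  unfold edgeNormal
  rw [key]
  refine mul_pos ?_ (hY _ _ ?_ ?_)
  · simpa using hY.vol_consecutive_pos hn (b + i + 1)
  · intro h
    have : ((i + 1 : ℕ) : ZMod n) = (0 : ℕ) := by push_cast; linear_combination h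
    exact ZMod.natCast_ne_natCast_of_lt (by omega) (by omega) (by omega) this
  · intro h
    have : ((i : ℕ) : ZMod n) = (0 : ℕ) := by push_cast; linear_combination h
    exact ZMod.natCast_ne_natCast_of_lt (by omega) (by omega) (by omega) this

/-- The dual cone is convex too. Positivity for adjacent normals propagates by induction on `k`
through the linear relation between four vectors, paired with `Y b`, which kills the term of
`edgeNormal Y b`. -/
theorem vol_edgeNormal_pos (hY : IsStrictlyConvexCone Y) (hn : 3 ≤ n) (b : ZMod n) {i k : ℕ}
    (hi : 1 ≤ i) (hik : i < k) (hk : k < n) :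
    0 < vol (edgeNormal Y (b + i)) (edgeNormal Y (b + k)) (edgeNormal Y b) := by
  induction k, hik using Nat.le_induction with
  | base => exact hY.vol_edgeNormal_succ_pos hn b hi hk
  | succ k hik ih =>
    have pos : ∀ m : ℕ, 1 ≤ m → m + 1 < n → 0 < edgeNormal Y (b + m) ⬝ᵥ Y b := by
      intro m hm hm'
      apply hY.edgeNormal_dotProduct_pos
      · intro h
        have : ((m : ℕ) : ZMod n) = (0 : ℕ) := by push_cast; linear_combination -h
        exact ZMod.natCast_ne_natCast_of_lt (by omega) (by omega) (by omega) this
      · intro h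
        have : ((m + 1 : ℕ) : ZMod n) = (0 : ℕ) := by push_cast; linear_combination -h
        exact ZMod.natCast_ne_natCast_of_lt (by omega) (by omega) (by omega) this
    have key := vol_mul_dotProduct (edgeNormal Y (b + i)) (edgeNormal Y (b + k))
      (edgeNormal Y (b + (k + 1 : ℕ))) (edgeNormal Y b) (Y b)
    have h0 : edgeNormal Y b ⬝ᵥ Y b = 0 := by
      rw [edgeNormal_dotProduct, vol_apply]; ring
    rw [h0, mul_zero, sub_zero] at key
    have hi' : i + 1 ≤ k := hik
    have h1 := ih (by omega)
    have h2 := hY.vol_edgeNormal_succ_pos hn b (i := k) (by omega) hk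
    have h3 := pos k (by omega) hk
    have h4 := pos i hi (by omega)
    -- Only weak positivity is available: for `k + 2 = n` this edge ends at `Y b`.
    have h5 := hY.edgeNormal_dotProduct_nonneg (b + (k + 1 : ℕ)) b
    refine pos_of_mul_pos_left ?_ h3.le
    rw [key]
    positivity

/-- Each summand is the increment of the dual vector `l` of the plane through three consecutive
nodes, so the cyclic sum telescopes. -/
theorem sum_smul_edgeNormal [NeZero n] (hY : IsStrictlyConvexCone Y) (hn : 3 ≤ n) :
    ∑ i, (halfDelta Y i / (vol (Y (i - 1)) (Y i) (Y (i + 1)) *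
      vol (Y i) (Y (i + 1)) (Y (i + 2)))) • edgeNormal Y i = 0 := by
  set l : ZMod n → Fin 3 → ℝ := fun i =>
    (vol (Y (i - 1)) (Y i) (Y (i + 1)))⁻¹ • triangleNormal (Y (i - 1)) (Y i) (Y (i + 1)) with hl
  have key : ∀ i, (halfDelta Y i / (vol (Y (i - 1)) (Y i) (Y (i + 1)) *
      vol (Y i) (Y (i + 1)) (Y (i + 2)))) • edgeNormal Y i = l (i + 1) - l i := by
    intro i
    have e : i + 1 + 1 = i + 2 := by ring
    have h1 := hY.vol_consecutive_pos hn i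
    have h2 := hY.vol_consecutive_pos hn (i + 1)
    simp only [hl, add_sub_cancel_right, e] at h1 h2 ⊢
    have h := triangleNormal_sub (Y (i - 1)) (Y i) (Y (i + 1)) (Y (i + 2))
    rw [div_eq_inv_mul, mul_smul, halfDelta, edgeNormal, ← h, smul_sub, smul_smul, smul_smul]
    congr 2 <;> field_simp
  rw [Finset.sum_congr rfl fun i _ => key i, Finset.sum_sub_distrib, sub_eq_zero]
  exact Equiv.sum_comp (Equiv.addRight (1 : ZMod n)) l

end IsStrictlyConvexCone

/-! ### Cyclic sign changes and the strictly convex case. -/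

theorem exists_adjacent_mul_neg {e : ℕ → ℝ} (he : ∀ k, e k ≠ 0) {m k : ℕ} (hmk : m ≤ k)
    (h : e m * e k < 0) : ∃ j, m ≤ j ∧ j < k ∧ e j * e (j + 1) < 0 := by
  induction k, hmk using Nat.le_induction with
  | base => exact absurd h (mul_self_nonneg _).not_gt
  | succ k hk ih =>
    by_cases h' : e m * e k < 0
    · obtain ⟨j, h1, h2, h3⟩ := ih h'
      exact ⟨j, h1, by omega, h3⟩
    · refine ⟨k, hk, by omega, ?_⟩
      have hpos : 0 < e m * e k := lt_of_le_of_ne (not_lt.1 h') (mul_ne_zero (he _) (he _)).symm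
      have hsq : 0 < e m * e m := mul_self_pos.2 (he m)
      nlinarith [mul_neg_of_pos_of_neg hpos h]

/-- A nowhere vanishing cyclic sequence with fewer than four sign changes consists of at most two
blocks of constant sign. -/
theorem constant_sign_or_two_blocks {n : ℕ} [NeZero n] {d : ZMod n → ℝ} (hd : ∀ i, d i ≠ 0)
    (h4 : Set.ncard {i : ZMod n | d (i - 1) * d i < 0} < 4) :
    (∀ i, 0 < d 0 * d i) ∨ ∃ (a : ZMod n) (b : ℕ), 1 ≤ b ∧ b < n ∧
      (∀ k < b, 0 < d a * d (a + k)) ∧ ∀ k, b ≤ k → k < n → d a * d (a + k) < 0 := by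
  have hn : 0 < n := NeZero.pos n
  by_cases hc : ∃ a, d (a - 1) * d a < 0
  · right
    obtain ⟨a, ha⟩ := hc
    set e : ℕ → ℝ := fun k => d a * d (a + k) with he
    have hda : 0 < d a * d a := mul_self_pos.2 (hd a)
    have he0 : 0 < e 0 := by simpa [he] using hda
    have hene : ∀ k, e k ≠ 0 := fun k => mul_ne_zero (hd _) (hd _)
    have hcast : ((n - 1 : ℕ) : ZMod n) = -1 := by
      rw [Nat.cast_sub hn]; simp
    have hlast : e (n - 1) < 0 := by
      simp only [he, hcast, ← sub_eq_add_neg]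
      linarith
    have hex : ∃ k, e k < 0 := ⟨_, hlast⟩
    classical
    have hb : e (Nat.find hex) < 0 := Nat.find_spec hex
    have hbn : Nat.find hex ≤ n - 1 := Nat.find_min' hex hlast
    have hb0 : Nat.find hex ≠ 0 := fun h => by rw [h] at hb; linarith
    have hbmin : ∀ k < Nat.find hex, 0 < e k := fun k hk =>
      lt_of_le_of_ne (not_lt.1 (Nat.find_min hex hk)) (hene k).symm
    generalize Nat.find hex = b at hb hbn hb0 hbmin
    refine ⟨a, b, by omega, by omega, hbmin, fun k hbk hkn => ?_⟩
    by_contra hk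
    have hkpos : 0 < e k := lt_of_le_of_ne (not_lt.1 hk) (hene k).symm
    have hflat : ∀ j, e j * e (j + 1) < 0 →
        a + ((j + 1 : ℕ) : ZMod n) ∈ {i : ZMod n | d (i - 1) * d i < 0} := by
      intro j hj
      have h1 : a + ((j + 1 : ℕ) : ZMod n) - 1 = a + j := by push_cast; ring
      simp only [Set.mem_ofPred_eq, h1]
      simp only [he] at hj
      by_contra h
      nlinarith [mul_nonneg hda.le (not_lt.1 h)]
    -- The signs of `e` at `0 < b < k < n - 1` would be +, -, +, -: three changes, besides the one
    -- at `a` itself.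
    obtain ⟨j₁, h11, h12, h13⟩ :=
      exists_adjacent_mul_neg hene (Nat.zero_le b) (mul_neg_of_pos_of_neg he0 hb)
    obtain ⟨j₂, h21, h22, h23⟩ :=
      exists_adjacent_mul_neg hene hbk (mul_neg_of_neg_of_pos hb hkpos)
    obtain ⟨j₃, h31, h32, h33⟩ :=
      exists_adjacent_mul_neg hene (by omega : k ≤ n - 1) (mul_neg_of_pos_of_neg hkpos hlast)
    have hinj : ∀ p q : ℕ, p < n → q < n → p ≠ q → a + (p : ZMod n) ≠ a + q := by
      intro p q hp hq hpq h
      exact ZMod.natCast_ne_natCast_of_lt hp hq hpq (add_left_cancel h)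
    have hsub : (({a + (0 : ℕ), a + (j₁ + 1 : ℕ), a + (j₂ + 1 : ℕ), a + (j₃ + 1 : ℕ)} :
        Finset (ZMod n)) : Set (ZMod n)) ⊆ {i : ZMod n | d (i - 1) * d i < 0} := by
      intro x hx
      simp only [Finset.coe_insert, Finset.coe_singleton, Set.mem_insert_iff,
        Set.mem_singleton_iff] at hx
      rcases hx with rfl | rfl | rfl | rfl
      · simpa using ha
      · exact hflat _ h13
      · exact hflat _ h23
      · exact hflat _ h33
    have hcard := Set.ncard_le_ncard hsub (Set.toFinite _)
    rw [Set.ncard_coe_finset, Finset.card_insert_of_notMem, Finset.card_insert_of_notMem,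
      Finset.card_insert_of_notMem, Finset.card_singleton] at hcard
    · omega
    · simp only [Finset.mem_singleton]
      exact hinj _ _ (by omega) (by omega) (by omega)
    · simp only [Finset.mem_insert, Finset.mem_singleton, not_or]
      exact ⟨hinj _ _ (by omega) (by omega) (by omega), hinj _ _ (by omega) (by omega) (by omega)⟩
    · simp only [Finset.mem_insert, Finset.mem_singleton, not_or]
      exact ⟨hinj _ _ (by omega) (by omega) (by omega),
        hinj _ _ (by omega) (by omega) (by omega), hinj _ _ (by omega) (by omega) (by omega)⟩
  · left
    push Not at hc
    have hpos : ∀ k : ℕ, 0 < d 0 * d k := by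
      intro k
      induction k with
      | zero => simpa using mul_self_pos.2 (hd 0)
      | succ k ih =>
        have h1 : 0 < d k * d (k + 1 : ℕ) := by
          have := hc ((k + 1 : ℕ) : ZMod n)
          have e : ((k + 1 : ℕ) : ZMod n) - 1 = k := by push_cast; ring
          rw [e] at this
          exact lt_of_le_of_ne this (mul_ne_zero (hd _) (hd _)).symm
        have h2 : 0 < d k * d k := mul_self_pos.2 (hd _)
        by_contra h
        nlinarith [mul_pos ih h1, mul_nonneg h2.le (neg_nonneg.2 (not_lt.1 h))]
    intro i
    simpa using hpos i.val

theorem IsStrictlyConvexCone.four_le_ncard {n : ℕ} [NeZero n] {Y : ZMod n → Fin 3 → ℝ}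
    (hY : IsStrictlyConvexCone Y) (hn : 3 ≤ n) (hD : ∀ i, halfDelta Y i ≠ 0) :
    4 ≤ Set.ncard {i : ZMod n | IsFlattening Y i} := by
  by_contra hlt
  have hpos : ∀ i, 0 < vol (Y (i - 1)) (Y i) (Y (i + 1)) * vol (Y i) (Y (i + 1)) (Y (i + 2)) := by
    intro i
    have h1 := hY.vol_consecutive_pos hn i
    have h2 := hY.vol_consecutive_pos hn (i + 1)
    have e : i + 1 + 1 = i + 2 := by ring
    rw [add_sub_cancel_right, e] at h2
    exact mul_pos h1 h2
  set c : ZMod n → ℝ := fun i => halfDelta Y i /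
    (vol (Y (i - 1)) (Y i) (Y (i + 1)) * vol (Y i) (Y (i + 1)) (Y (i + 2))) with hc
  have hsum : ∀ v : Fin 3 → ℝ, ∑ i, c i * (edgeNormal Y i ⬝ᵥ v) = 0 := by
    intro v
    have h := congrArg (· ⬝ᵥ v) (hY.sum_smul_edgeNormal hn)
    simpa [sum_dotProduct] using h
  have hmul : ∀ (t : ℝ) i, t * c i = (t * halfDelta Y i) /
    (vol (Y (i - 1)) (Y i) (Y (i + 1)) * vol (Y i) (Y (i + 1)) (Y (i + 2))) := by
    intro t i; rw [hc, mul_div_assoc]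
  rcases constant_sign_or_two_blocks hD (by simpa [IsFlattening] using hlt) with
    h | ⟨a, b, hb1, hbn, hlo, hhi⟩
  · have h0 : 0 < ∑ i, halfDelta Y 0 * (c i * (edgeNormal Y i ⬝ᵥ Y 0)) := by
      have hcpos : ∀ i, 0 < halfDelta Y 0 * c i := fun i => by
        rw [hmul]; exact div_pos (h i) (hpos i)
      -- Since `n ≥ 3`, node `0` is not an end of edge `1`, so that term is strictly positive.
      refine Finset.sum_pos' (fun i _ => ?_) ⟨1, Finset.mem_univ _, ?_⟩
      · rw [← mul_assoc]
        exact mul_nonneg (hcpos i).le (hY.edgeNormal_dotProduct_nonneg i 0)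
      · rw [← mul_assoc]
        refine mul_pos (hcpos 1) (hY.edgeNormal_dotProduct_pos ?_ ?_)
        · have := ZMod.natCast_ne_natCast_of_lt (n := n) (i := 0) (k := 1) (by omega) (by omega)
            (by omega)
          simpa using this
        · have := ZMod.natCast_ne_natCast_of_lt (n := n) (i := 0) (k := 2) (by omega) (by omega)
            (by omega)
          have e : (1 : ZMod n) + 1 = 2 := by norm_num
          rw [e]
          simpa using this
    rw [← Finset.mul_sum, hsum, mul_zero] at h0
    exact lt_irrefl _ h0
  · have hdual : ∀ u w x : Fin 3 → ℝ, u ⬝ᵥ crossProduct w x = vol u w x := by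
      intro u w x
      rw [dotProduct_comm, dotProduct_crossProduct_eq_vol, vol_apply, vol_apply]
      ring
    have hanti : ∀ u w x : Fin 3 → ℝ, vol u w x = - vol w u x := by
      intro u w x
      rw [vol_apply, vol_apply]; ring
    -- sign of the pairing of each edge normal with the intersection of the two edge planes
    have hzero : ∀ i, i = a ∨ i = a + b →
        vol (edgeNormal Y i) (edgeNormal Y (a + b)) (edgeNormal Y a) = 0 := by
      rintro i (rfl | rfl) <;> rw [vol_apply] <;> ring
    have hneg : ∀ k, b < k → k < n →
        vol (edgeNormal Y (a + k)) (edgeNormal Y (a + b)) (edgeNormal Y a) < 0 := by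
      intro k hk hkn
      have h := hY.vol_edgeNormal_pos hn a hb1 hk hkn
      rw [hanti]
      linarith
    have hplus : ∀ k, 0 < k → k < b →
        0 < vol (edgeNormal Y (a + k)) (edgeNormal Y (a + b)) (edgeNormal Y a) := by
      intro k hk hkb
      exact hY.vol_edgeNormal_pos hn a hk hkb hbn
    have hterm : ∀ k, k < n → k ≠ 0 → k ≠ b → 0 < halfDelta Y a * (c (a + k) *
        vol (edgeNormal Y (a + k)) (edgeNormal Y (a + b)) (edgeNormal Y a)) := by
      intro k hkn hk0 hkb
      rw [← mul_assoc, hmul]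
      rcases lt_or_gt_of_ne hkb with h | h
      · exact mul_pos (div_pos (hlo k h) (hpos _)) (hplus k (by omega) h)
      · exact mul_pos_of_neg_of_neg (div_neg_of_neg_of_pos (hhi k h.le hkn) (hpos _))
          (hneg k h hkn)
    have hrep : ∀ i : ZMod n, ∃ k < n, i = a + (k : ZMod n) := fun i =>
      ⟨(i - a).val, ZMod.val_lt _, by simp⟩
    have h0 : 0 < ∑ i, halfDelta Y a * (c i *
        vol (edgeNormal Y i) (edgeNormal Y (a + b)) (edgeNormal Y a)) := by
      refine Finset.sum_pos' (fun i _ => ?_) ?_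
      · obtain ⟨k, hkn, rfl⟩ := hrep i
        by_cases hk0 : k = 0
        · rw [hzero _ (Or.inl (by simp [hk0]))]; simp
        by_cases hkb : k = b
        · rw [hzero _ (Or.inr (by simp [hkb]))]; simp
        exact (hterm k hkn hk0 hkb).le
      -- Any index below `n` other than `0` and `b` gives a strictly positive term; `n ≥ 3` provides
      -- one.
      · by_cases hb : b = 1
        · exact ⟨_, Finset.mem_univ _, hterm 2 (by omega) (by omega) (by omega)⟩
        · exact ⟨_, Finset.mem_univ _, hterm 1 (by omega) (by omega) (by omega)⟩
    rw [← Finset.mul_sum] at h0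
    have h1 := hsum (crossProduct (edgeNormal Y (a + b)) (edgeNormal Y a))
    simp only [hdual] at h1
    rw [h1, mul_zero] at h0
    exact lt_irrefl _ h0

/-! ### Straight angles, by perturbation. -/

theorem vol_smul_smul_smul (a b c : ℝ) (u v w : Fin 3 → ℝ) :
    vol (a • u) (b • v) (c • w) = a * b * c * vol u v w := by
  simp [vol_apply]; ring

theorem vol_neg_neg_neg (u v w : Fin 3 → ℝ) : vol (-u) (-v) (-w) = -vol u v w := by
  simp [vol_apply]; ring

theorem vol_sum {ι : Type*} (s : Finset ι) (u v : Fin 3 → ℝ) (f : ι → Fin 3 → ℝ) :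
    vol u v (∑ j ∈ s, f j) = ∑ j ∈ s, vol u v (f j) := by
  simp only [← dotProduct_crossProduct_eq_vol, dotProduct_sum]

theorem Continuous.vol {α : Type*} [TopologicalSpace α] {u v w : α → Fin 3 → ℝ}
    (hu : Continuous u) (hv : Continuous v) (hw : Continuous w) :
    Continuous fun x => vol (u x) (v x) (w x) := by
  simp only [vol_apply]
  fun_prop

/-- Lifting the three collinear points `u`, `v`, `(1 - t) • u + t • v` towards `c` by a strictly
convex function of the point makes them independent. -/
theorem vol_add_smul_of_collinear (u v c : Fin 3 → ℝ) (e t : ℝ) :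
    vol (u + e • (u ⬝ᵥ u) • c) (v + e • (v ⬝ᵥ v) • c)
      (((1 - t) • u + t • v) +
        e • (((1 - t) • u + t • v) ⬝ᵥ ((1 - t) • u + t • v)) • c) =
    e * (t * (t - 1) * ((v - u) ⬝ᵥ (v - u)) * vol u v c) := by
  simp [vol_apply, dotProduct, Fin.sum_univ_three]
  ring

/-- A polygon `Q` seen from the origin as a convex positively oriented polygon, straight angles
allowed. -/
structure IsConvexCone {n : ℕ} (Q : ZMod n → Fin 3 → ℝ) : Prop where
  ne : ∀ i, Q i ≠ Q (i + 1)
  nonneg : ∀ i j, 0 ≤ vol (Q i) (Q (i + 1)) (Q j)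
  exists_pos : ∀ i, ∃ j, 0 < vol (Q i) (Q (i + 1)) (Q j)
  collinear : ∀ i j, j ≠ i → j ≠ i + 1 → vol (Q i) (Q (i + 1)) (Q j) = 0 →
    ∃ t : ℝ, 0 < t * (t - 1) ∧ Q j = (1 - t) • Q i + t • Q (i + 1)

theorem IsConvexCone.four_le_ncard {n : ℕ} [NeZero n] {Q : ZMod n → Fin 3 → ℝ}
    (hQ : IsConvexCone Q) {r : ZMod n → ℝ} (hr : ∀ i, 0 < r i) (hn : 3 ≤ n)
    (hD : ∀ i, halfDelta (fun i => r i • Q i) i ≠ 0) :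
    4 ≤ Set.ncard {i : ZMod n | IsFlattening (fun i => r i • Q i) i} := by
  -- The sum of the nodes lies strictly inside every edge plane, so lifting towards it by `e * |Q
  -- i|²` bends straight angles the convex way for `e > 0`. The strict inequalities, including the
  -- signs of `halfDelta`, survive for small `e`.
  set c := ∑ j, Q j with hc
  set Z : ℝ → ZMod n → Fin 3 → ℝ :=
    fun e i => r i • (Q i + e • (Q i ⬝ᵥ Q i) • c) with hZ
  have hZ0 : Z 0 = fun i => r i • Q i := by simp [hZ]
  have hZc : ∀ i, Continuous fun e => Z e i := fun i => by simp only [hZ]; fun_prop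
  have hcpos : ∀ i, 0 < vol (Q i) (Q (i + 1)) c := by
    intro i
    rw [hc, vol_sum]
    obtain ⟨j, hj⟩ := hQ.exists_pos i
    exact Finset.sum_pos' (fun j _ => hQ.nonneg i j) ⟨j, Finset.mem_univ _, hj⟩
  have hconv : ∀ᶠ e in nhdsWithin (0 : ℝ) (Set.Ioi 0), IsStrictlyConvexCone (Z e) := by
    refine Filter.eventually_all.2 fun i => Filter.eventually_all.2 fun j => ?_
    by_cases hji : j = i
    · exact Filter.Eventually.of_forall fun e h => absurd hji h
    by_cases hji' : j = i + 1
    · exact Filter.Eventually.of_forall fun e _ h => absurd hji' h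
    rcases (hQ.nonneg i j).lt_or_eq with h | h
    · have hcont : Continuous fun e => vol (Z e i) (Z e (i + 1)) (Z e j) :=
        (hZc i).vol (hZc _) (hZc j)
      have h0 : 0 < vol (Z 0 i) (Z 0 (i + 1)) (Z 0 j) := by
        rw [hZ0, vol_smul_smul_smul]
        exact mul_pos (mul_pos (mul_pos (hr _) (hr _)) (hr _)) h
      filter_upwards [(hcont.tendsto 0).eventually_const_lt h0 |>.filter_mono
        nhdsWithin_le_nhds] with e he _ _ using he
    · obtain ⟨t, ht, htQ⟩ := hQ.collinear i j hji hji' h.symm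
      filter_upwards [self_mem_nhdsWithin] with e he _ _
      simp only [hZ]
      rw [vol_smul_smul_smul, htQ, vol_add_smul_of_collinear]
      have hd : 0 < (Q (i + 1) - Q i) ⬝ᵥ (Q (i + 1) - Q i) :=
        lt_of_le_of_ne (by simpa using dotProduct_star_self_nonneg (Q (i + 1) - Q i))
          fun h0 => hQ.ne i (sub_eq_zero.1 (dotProduct_self_eq_zero.1 h0.symm)).symm
      exact mul_pos (mul_pos (mul_pos (hr _) (hr _)) (hr _))
        (mul_pos he (mul_pos (mul_pos ht hd) (hcpos i)))
  have hsign : ∀ᶠ e in nhdsWithin (0 : ℝ) (Set.Ioi 0),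
      ∀ i, 0 < halfDelta (Z 0) i * halfDelta (Z e) i := by
    refine Filter.eventually_all.2 fun i => ?_
    have hcont : Continuous fun e => halfDelta (Z 0) i * halfDelta (Z e) i := by
      refine continuous_const.mul (Continuous.vol ?_ ?_ ?_) <;> exact (hZc _).sub (hZc _)
    have h0 : 0 < halfDelta (Z 0) i * halfDelta (Z 0) i :=
      mul_self_pos.2 (by rw [hZ0]; exact hD i)
    exact (hcont.tendsto 0).eventually_const_lt h0 |>.filter_mono nhdsWithin_le_nhds
  obtain ⟨e, he, hes⟩ := (hconv.and hsign).exists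
  rw [hZ0] at hes
  have h := he.four_le_ncard hn fun i hi => by simpa [hi] using hes i
  refine h.trans (Set.ncard_le_ncard (fun i hi => ?_) (Set.toFinite _))
  have h1 := hes (i - 1)
  have h2 := hes i
  have h3 : halfDelta (Z e) (i - 1) * halfDelta (Z e) i < 0 := hi
  change halfDelta (fun i => r i • Q i) (i - 1) * halfDelta (fun i => r i • Q i) i < 0
  by_contra h4
  nlinarith [mul_pos h1 h2, mul_nonneg (neg_nonneg.2 h3.le) (not_lt.1 h4)]

/-! ### From the geometric hypotheses to convex cones. -/

theorem halfDelta_neg {n : ℕ} (X : ZMod n → Fin 3 → ℝ) (i : ZMod n) :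
    halfDelta (-X) i = -halfDelta X i := by
  rw [halfDelta, halfDelta, ← vol_neg_neg_neg]
  congr 1 <;> simp [sub_eq_add_neg, add_comm]

theorem halfDelta_sub_const {n : ℕ} (X : ZMod n → Fin 3 → ℝ) (O : Fin 3 → ℝ) (i : ZMod n) :
    halfDelta (fun i => X i - O) i = halfDelta X i := by
  simp [halfDelta]

theorem isFlattening_neg {n : ℕ} (X : ZMod n → Fin 3 → ℝ) (i : ZMod n) :
    IsFlattening (-X) i ↔ IsFlattening X i := by
  simp [IsFlattening, halfDelta_neg]

theorem isFlattening_sub_const {n : ℕ} (X : ZMod n → Fin 3 → ℝ) (O : Fin 3 → ℝ) (i : ZMod n) :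
    IsFlattening (fun i => X i - O) i ↔ IsFlattening X i := by
  simp [IsFlattening, halfDelta_sub_const]

theorem exists_smul_add_smul_of_vol_eq_zero {u v w : Fin 3 → ℝ} (h : vol u v w = 0) :
    ∃ a b c : ℝ, (a ≠ 0 ∨ b ≠ 0 ∨ c ≠ 0) ∧ a • u + b • v + c • w = 0 := by
  obtain ⟨x, hx, h0⟩ := Matrix.exists_vecMul_eq_zero_iff.2 h
  refine ⟨x 0, x 1, x 2, ?_, ?_⟩
  · by_contra hcon
    push Not at hcon
    exact hx (funext fun k => by fin_cases k <;> simp [hcon])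
  · rw [← h0]
    ext k
    simp [Matrix.vecMul, dotProduct, Fin.sum_univ_three]

theorem IsGeneric.halfDelta_ne_zero {n : ℕ} {X : ZMod n → Fin 3 → ℝ} (hX : IsGeneric X)
    (i : ZMod n) : halfDelta X i ≠ 0 := by
  intro h
  apply hX i
  rw [coplanar_iff_finrank_le_two]
  set S : Set (Fin 3 → ℝ) := {X (i + 2) - X (i + 1), X (i + 1) - X i, X i - X (i - 1)} with hS
  have hle : vectorSpan ℝ {X (i - 1), X i, X (i + 1), X (i + 2)} ≤ Submodule.span ℝ S := by
    have h1 : X (i + 2) - X (i + 1) ∈ Submodule.span ℝ S := Submodule.subset_span (by simp [hS])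
    have h2 : X (i + 1) - X i ∈ Submodule.span ℝ S := Submodule.subset_span (by simp [hS])
    have h3 : X i - X (i - 1) ∈ Submodule.span ℝ S := Submodule.subset_span (by simp [hS])
    rw [vectorSpan_eq_span_vsub_set_right ℝ (p := X (i - 1)) (by simp), Submodule.span_le]
    rintro _ ⟨x, hx, rfl⟩
    simp only [Set.mem_insert_iff, Set.mem_singleton_iff] at hx
    simp only [vsub_eq_sub, SetLike.mem_coe]
    rcases hx with rfl | rfl | rfl | rfl
    · simp
    · exact h3
    · simpa using add_mem h2 h3
    · simpa using add_mem h1 (add_mem h2 h3)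
  refine (Submodule.finrank_mono hle).trans ?_
  have hdep : ¬ LinearIndependent ℝ ![X (i + 2) - X (i + 1), X (i + 1) - X i, X i - X (i - 1)] := by
    intro hli
    have := Matrix.linearIndependent_rows_iff_isUnit.1
      (show LinearIndependent ℝ (Matrix.of
        ![X (i + 2) - X (i + 1), X (i + 1) - X i, X i - X (i - 1)]).row from hli)
    rw [Matrix.isUnit_iff_isUnit_det] at this
    exact this.ne_zero h
  rw [linearIndependent_iff_card_le_finrank_span] at hdep
  have hr : Set.range ![X (i + 2) - X (i + 1), X (i + 1) - X i, X i - X (i - 1)] = S := by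
    simp only [hS, Matrix.range_cons, Matrix.range_empty, Set.union_empty, Set.singleton_union]
  rw [hr, Fintype.card_fin] at hdep
  simp only [Set.finrank] at hdep
  omega

/-- For `n ≤ 3`, four cyclically consecutive nodes repeat a point, so `halfDelta` vanishes. -/
theorem IsGeneric.four_le {n : ℕ} [NeZero n] {X : ZMod n → Fin 3 → ℝ} (hX : IsGeneric X) :
    4 ≤ n := by
  have h := hX.halfDelta_ne_zero 0
  by_contra hn
  have hn0 := NeZero.pos n
  obtain rfl | rfl | rfl : n = 1 ∨ n = 2 ∨ n = 3 := by omega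
  all_goals apply h
  · have e : ∀ i : ZMod 1, X i = X 0 := fun i => congrArg X (Subsingleton.elim _ _)
    rw [halfDelta, e (0 + 2), e (0 + 1), e (0 - 1), vol_apply]
    simp
  · have e : (0 : ZMod 2) + 2 = 0 := by decide
    rw [halfDelta, e, vol_apply]
    simp
    ring
  · have e : (0 : ZMod 3) + 2 = 0 - 1 := by decide
    rw [halfDelta, e, vol_apply]
    simp
    ring

theorem exists_dual_eq_one {O : Fin 3 → ℝ} {H : AffineSubspace ℝ (Fin 3 → ℝ)} (hO : O ∉ H) :
    ∃ g : (Fin 3 → ℝ) →ₗ[ℝ] ℝ, ∀ p ∈ H, g (p - O) = 1 := by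
  by_cases hne : (H : Set (Fin 3 → ℝ)).Nonempty
  · obtain ⟨p, hp⟩ := hne
    have hpO : p - O ∉ H.direction := by
      intro h
      apply hO
      have := AffineSubspace.vadd_mem_of_mem_direction (neg_mem h) hp
      simpa using this
    obtain ⟨f, hf, hker⟩ := Submodule.exists_le_ker_of_notMem hpO
    refine ⟨(f (p - O))⁻¹ • f, fun q hq => ?_⟩
    have hq' : f (q - p) = 0 := hker (AffineSubspace.vsub_mem_direction hq hp)
    have e : q - O = (q - p) + (p - O) := by abel
    rw [LinearMap.smul_apply, e, map_add, hq', zero_add, smul_eq_mul, inv_mul_cancel₀ hf]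
  · exact ⟨0, fun p hp => absurd ⟨p, hp⟩ hne⟩

theorem IsSimplePolygon.ne_of_mem_Icc {n : ℕ} {P : ZMod n → Fin 3 → ℝ} (hP : IsSimplePolygon P)
    {i j : ZMod n} (h : j ≠ i) (h' : j ≠ i + 1) {t : ℝ} (ht : t ∈ Set.Icc (0 : ℝ) 1) :
    P j ≠ AffineMap.lineMap (P i) (P (i + 1)) t := by
  intro e
  have h0 : (0 : ℝ) ∈ Set.Ico (0 : ℝ) 1 := ⟨le_rfl, one_pos⟩
  rcases ht.2.lt_or_eq with h1 | rfl
  · have := @hP (j, ⟨0, h0⟩) (i, ⟨t, ht.1, h1⟩) (by simpa using e)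
    exact h (congrArg Prod.fst this)
  · have := @hP (j, ⟨0, h0⟩) (i + 1, ⟨0, h0⟩) (by simpa using e)
    exact h' (congrArg Prod.fst this)

theorem vol_mul_vol_nonneg_of_wSameSide {O p q x y : Fin 3 → ℝ}
    (h : (line[ℝ, p, q]).WSameSide x y) :
    0 ≤ vol (p - O) (q - O) (x - O) * vol (p - O) (q - O) (y - O) := by
  obtain ⟨p₁, hp₁, p₂, hp₂, hray⟩ := h
  have hline : ∀ z ∈ line[ℝ, p, q], ∀ x, vol (p - O) (q - O) (x - O) =
      vol (p - O) (q - O) (x -ᵥ z) := by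
    intro z hz x
    obtain ⟨t, rfl⟩ := mem_affineSpan_pair_iff_exists_lineMap_eq.1 hz
    simp only [vol_apply, AffineMap.lineMap_apply, vsub_eq_sub, vadd_eq_add, Pi.sub_apply,
      Pi.add_apply, Pi.smul_apply, smul_eq_mul]
    ring
  rw [hline p₁ hp₁ x, hline p₂ hp₂ y]
  rcases hray with h | h | ⟨a, b, ha, hb, h⟩
  · rw [h]; simp [vol_apply]
  · rw [h]; simp [vol_apply]
  · have h1 : a * vol (p - O) (q - O) (x -ᵥ p₁) = b * vol (p - O) (q - O) (y -ᵥ p₂) := by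
      have := congrArg (vol (p - O) (q - O)) h
      rw [← one_smul ℝ (p - O), ← one_smul ℝ (q - O), vol_smul_smul_smul, vol_smul_smul_smul] at this
      simpa using this
    by_contra hneg
    push Not at hneg
    have h2 := mul_neg_of_pos_of_neg (mul_pos ha hb) hneg
    have h3 : a * b * (vol (p - O) (q - O) (x -ᵥ p₁) * vol (p - O) (q - O) (y -ᵥ p₂)) =
        (a * vol (p - O) (q - O) (x -ᵥ p₁)) * (a * vol (p - O) (q - O) (x -ᵥ p₁)) := by
      linear_combination (-(a * vol (p - O) (q - O) (x -ᵥ p₁))) * h1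
    rw [h3] at h2
    exact (mul_self_nonneg _).not_gt h2

theorem exists_combination_of_vol_eq_zero {g : (Fin 3 → ℝ) →ₗ[ℝ] ℝ} {u v w : Fin 3 → ℝ}
    (hu : g u = 1) (hv : g v = 1) (hw : g w = 1) (huv : u ≠ v) (h : vol u v w = 0) :
    ∃ t : ℝ, w = (1 - t) • u + t • v := by
  obtain ⟨a, b, c, hne, h0⟩ := exists_smul_add_smul_of_vol_eq_zero h
  have hg : a + b + c = 0 := by
    have := congrArg g h0
    simpa [hu, hv, hw] using this
  have hc : c ≠ 0 := by
    rintro rfl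
    have hb : b = -a := by linarith
    subst hb
    have ha : a ≠ 0 := by
      rintro rfl
      simp at hne
    apply huv
    have h1 : a • (u - v) = 0 := by rw [← h0]; module
    exact sub_eq_zero.1 ((smul_eq_zero.1 h1).resolve_left ha)
  refine ⟨-b / c, ?_⟩
  have ha : a = -b - c := by linarith
  subst ha
  apply smul_right_injective _ hc
  have e : c • w = (b + c) • u - b • v := by
    rw [← sub_eq_zero, ← h0]; module
  have e1 : c * (1 - -b / c) = b + c := by field_simp; ring
  have e2 : c * (-b / c) = -b := by field_simp
  simp only [smul_add, smul_smul, e, e1, e2]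
  module

/-- Up to orientation, the cone over a convex polygon is a convex cone in the sense of
`IsConvexCone`. -/
theorem isConvexCone_or_neg {n : ℕ} [NeZero n] {Q : ZMod n → Fin 3 → ℝ} (hn : 3 ≤ n)
    (hne : ∀ i, Q i ≠ Q (i + 1))
    (hside : ∀ i j k, 0 ≤ vol (Q i) (Q (i + 1)) (Q j) * vol (Q i) (Q (i + 1)) (Q k))
    (hex : ∀ i, ∃ j, vol (Q i) (Q (i + 1)) (Q j) ≠ 0)
    (hcol : ∀ i j, j ≠ i → j ≠ i + 1 → vol (Q i) (Q (i + 1)) (Q j) = 0 →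
      ∃ t : ℝ, 0 < t * (t - 1) ∧ Q j = (1 - t) • Q i + t • Q (i + 1)) :
    IsConvexCone Q ∨ IsConvexCone (-Q) := by
  have hdist : ∀ i : ZMod n, ∀ k : ℕ, 0 < k → k < n → i ≠ i + (k : ZMod n) := by
    intro i k hk hkn h
    apply ZMod.natCast_ne_natCast_of_lt (n := n) (i := 0) (k := k) (by omega) hkn (by omega)
    push_cast
    linear_combination h
  -- Orientation passes from an edge to the next one: at a genuine corner by comparing with the node
  -- `i`, at a straight angle because the two edge planes coincide.
  have hstep : ∀ (s : ℝ) i, (∀ j, 0 ≤ s * vol (Q i) (Q (i + 1)) (Q j)) →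
      ∀ j, 0 ≤ s * vol (Q (i + 1)) (Q (i + 1 + 1)) (Q j) := by
    intro s i hs j
    by_cases h0 : vol (Q i) (Q (i + 1)) (Q (i + 1 + 1)) = 0
    · have hi1 : i ≠ i + 1 := by simpa using hdist i 1 (by omega) (by omega)
      have hi2 : i ≠ i + 1 + 1 := by
        have := hdist i 2 (by omega) (by omega)
        have e : i + 1 + 1 = i + (2 : ℕ) := by push_cast; ring
        rwa [e]
      have hi3 : i + 1 + 1 ≠ i + 1 := fun h => hi1 (add_right_cancel h).symm
      obtain ⟨t, ht, e⟩ := hcol i (i + 1 + 1) hi2.symm hi3 h0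
      have hscale : ∀ j, vol (Q (i + 1)) (Q (i + 1 + 1)) (Q j) =
          (t - 1) * vol (Q i) (Q (i + 1)) (Q j) := by
        intro j
        rw [e]
        simp [vol_apply]
        ring
      -- The alternative `t < 0` is a backtrack: `Q i` would lie on the edge from `Q (i + 1)` to `Q
      -- (i + 1 + 1)`, which `hcol` forbids.
      have ht1 : 0 < t - 1 := by
        by_contra hlt
        have ht0 : t < 0 := by
          by_contra h
          nlinarith [mul_nonneg (not_lt.1 h) (sub_nonneg.2 (not_lt.1 hlt))]
        have hv : vol (Q (i + 1)) (Q (i + 1 + 1)) (Q i) = 0 := by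
          rw [hscale, vol_apply]; ring
        obtain ⟨u, hu, e'⟩ := hcol (i + 1) i hi1 hi2 hv
        rw [e] at e'
        have e3 : (1 - u * (1 - t)) • (Q i - Q (i + 1)) = 0 := by
          have : (1 - u * (1 - t)) • (Q i - Q (i + 1)) =
              Q i - ((1 - u) • Q (i + 1) + u • ((1 - t) • Q i + t • Q (i + 1))) := by module
          rw [this, ← e', sub_self]
        have e4 : 1 - u * (1 - t) = 0 :=
          (smul_eq_zero.1 e3).resolve_right (sub_ne_zero.2 (hne i))
        have hu0 : 0 < u := by
          by_contra h
          nlinarith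
        have hu1 : u < 1 := by nlinarith
        nlinarith
      rw [hscale]
      have := mul_nonneg ht1.le (hs j)
      linarith
    · have hcyc : vol (Q (i + 1)) (Q (i + 1 + 1)) (Q i) =
          vol (Q i) (Q (i + 1)) (Q (i + 1 + 1)) := by
        rw [vol_apply, vol_apply]; ring
      have h1 := hside (i + 1) i j
      rw [hcyc] at h1
      have h2 := hs (i + 1 + 1)
      have h3 : 0 < vol (Q i) (Q (i + 1)) (Q (i + 1 + 1)) ^ 2 := by positivity
      refine nonneg_of_mul_nonneg_right ?_ h3
      have := mul_nonneg h2 h1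
      linarith
  obtain ⟨j₀, hj₀⟩ := hex 0
  have hall : ∀ i j, 0 ≤ vol (Q 0) (Q (0 + 1)) (Q j₀) * vol (Q i) (Q (i + 1)) (Q j) := by
    have : ∀ (k : ℕ) j, 0 ≤ vol (Q 0) (Q (0 + 1)) (Q j₀) *
        vol (Q (k : ZMod n)) (Q ((k : ZMod n) + 1)) (Q j) := by
      intro k
      induction k with
      | zero => simpa using hside 0 j₀
      | succ k ih => simpa using hstep _ _ ih
    intro i
    simpa using this i.val
  rcases lt_or_gt_of_ne hj₀ with h | h
  · right
    have hnn : ∀ i j, vol (Q i) (Q (i + 1)) (Q j) ≤ 0 := fun i j => by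
      by_contra hc
      exact (hall i j).not_gt (mul_neg_of_neg_of_pos h (not_le.1 hc))
    refine ⟨fun i hi => hne i (neg_injective hi), fun i j => ?_, fun i => ?_,
      fun i j h1 h2 h3 => ?_⟩
    · simpa [vol_neg_neg_neg] using hnn i j
    · obtain ⟨j, hj⟩ := hex i
      exact ⟨j, by simpa [vol_neg_neg_neg] using lt_of_le_of_ne (hnn i j) hj⟩
    · obtain ⟨t, ht, e⟩ := hcol i j h1 h2 (by simpa [vol_neg_neg_neg] using h3)
      refine ⟨t, ht, ?_⟩
      simp only [Pi.neg_apply, e]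
      module
  · left
    have hnn : ∀ i j, 0 ≤ vol (Q i) (Q (i + 1)) (Q j) := fun i j => by
      by_contra hc
      exact (hall i j).not_gt (mul_neg_of_pos_of_neg h (not_le.1 hc))
    refine ⟨hne, hnn, fun i => ?_, hcol⟩
    obtain ⟨j, hj⟩ := hex i
    exact ⟨j, lt_of_le_of_ne (hnn i j) hj.symm⟩

/-! ### The theorem. -/

theorem mainTheorem1 (n : ℕ) [NeZero n] (X : ZMod n → Fin 3 → ℝ)
    (hgen : IsGeneric X)
    (hproj : ∃ (O : Fin 3 → ℝ) (H : AffineSubspace ℝ (Fin 3 → ℝ)) (P : ZMod n → Fin 3 → ℝ),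
      Module.finrank ℝ H.direction = 2 ∧ O ∉ H ∧
        IsRadialProjection O H X P ∧ IsConvexPolygonIn H P) :
    4 ≤ Set.ncard {i : ZMod n | IsFlattening X i} := by
  obtain ⟨O, H, P, -, hO, hrad, hconv⟩ := hproj
  have hn := hgen.four_le
  obtain ⟨g, hg⟩ := exists_dual_eq_one hO
  choose _ r hr hX using hrad
  set Q : ZMod n → Fin 3 → ℝ := fun i => P i - O with hQ
  have hgQ : ∀ i, g (Q i) = 1 := fun i => hg _ (hconv.mem i)
  have hXQ : (fun i => r i • Q i) = fun i => X i - O := funext fun i => (hX i).symm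
  have hD : ∀ i, halfDelta (fun i => r i • Q i) i ≠ 0 := fun i => by
    rw [hXQ, halfDelta_sub_const]
    exact hgen.halfDelta_ne_zero i
  have hone : ∀ i : ZMod n, i ≠ i + 1 := fun i h => by
    have := ZMod.natCast_ne_natCast_of_lt (n := n) (i := 0) (k := 1) (by omega) (by omega)
      (by omega)
    apply this
    push_cast
    linear_combination h
  have hne : ∀ i, Q i ≠ Q (i + 1) := by
    intro i h
    have h0 : (0 : ℝ) ∈ Set.Ico (0 : ℝ) 1 := ⟨le_rfl, one_pos⟩
    have := @hconv.simple (i, ⟨0, h0⟩) (i + 1, ⟨0, h0⟩) (by simpa [hQ] using h)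
    exact hone i (congrArg Prod.fst this)
  have hcol : ∀ i j, j ≠ i → j ≠ i + 1 → vol (Q i) (Q (i + 1)) (Q j) = 0 →
      ∃ t : ℝ, 0 < t * (t - 1) ∧ Q j = (1 - t) • Q i + t • Q (i + 1) := by
    intro i j h1 h2 h3
    obtain ⟨t, ht⟩ := exists_combination_of_vol_eq_zero (hgQ i) (hgQ _) (hgQ j) (hne i) h3
    -- Simplicity excludes `t` from `[0, 1]`, which is exactly `0 < t * (t - 1)`.
    refine ⟨t, ?_, ht⟩
    have ht' : P j = AffineMap.lineMap (P i) (P (i + 1)) t := by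
      rw [AffineMap.lineMap_apply_module, ← sub_eq_zero]
      have : Q j - ((1 - t) • Q i + t • Q (i + 1)) = 0 := sub_eq_zero.2 ht
      rw [← this]
      simp only [hQ]
      module
    by_contra hcon
    refine hconv.simple.ne_of_mem_Icc h1 h2 ⟨?_, ?_⟩ ht' <;> by_contra h <;> nlinarith
  -- Otherwise four consecutive nodes would lie in one plane through `O`, against genericity.
  have hex : ∀ i, ∃ j, vol (Q i) (Q (i + 1)) (Q j) ≠ 0 := by
    intro i
    by_contra! h
    obtain ⟨t, ht⟩ := exists_combination_of_vol_eq_zero (hgQ i) (hgQ _) (hgQ _) (hne i) (h (i - 1))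
    obtain ⟨u, hu⟩ := exists_combination_of_vol_eq_zero (hgQ i) (hgQ _) (hgQ _) (hne i) (h (i + 2))
    apply hD i
    simp only [halfDelta, ht, hu]
    simp [vol_apply]
    ring
  have hside : ∀ i j k, 0 ≤ vol (Q i) (Q (i + 1)) (Q j) * vol (Q i) (Q (i + 1)) (Q k) :=
    fun i j k => vol_mul_vol_nonneg_of_wSameSide (hconv.sameSide i j k)
  rcases isConvexCone_or_neg (by omega) hne hside hex hcol with h | h
  · have := h.four_le_ncard hr (by omega) hD
    simpa only [hXQ, isFlattening_sub_const] using this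
  · have e : (fun i => r i • (-Q) i) = -fun i => X i - O := by
      rw [← hXQ]; ext i; simp
    have := h.four_le_ncard hr (by omega) fun i => by
      rw [e, halfDelta_neg, halfDelta_sub_const, neg_ne_zero]
      exact hgen.halfDelta_ne_zero i
    simpa only [e, isFlattening_neg, isFlattening_sub_const] using this
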